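/- Let $G=(V,E)$ be a finite undirected simple graph with at least one vertex, let $\lambda_{\min}$ be the smallest eigenvalue of its adjacency matrix, and let $\alpha>0$, $\tau>0$. In the perishable public goods game on $G$ with shelf time $\tau$, every player $i\in V$ chooses an effort $y_i\ge 0$ and receives the utility $$U(y_i,y_{-i}) = 1-e^{-\tau(y_i+y_{-i})}-\frac{y_i^{\alpha+1}}{\alpha+1},\qquad y_{-i}=\sum_{j\in N(i)}y_j ,$$ where $N(i)$ is the set of neighbors of $i$. A (pure) Nash equilibrium is a vector $(y_i)_{i\in V}$ of nonnegative efforts such that, for every $i$, $y_i$ maximizes $x\mapsto U(x,y_{-i})$ over $x\ge 0$. Put $$\hat\tau=\Big(\frac{\alpha}{-\lambda_{\min}-1}\Big)^{\frac{\alpha}{\alpha+1}}\exp\Big(\frac{\alpha}{(\alpha+1)(-\lambda_{\min}-1)}\Big)\quad\text{if }\lambda_{\min}<-1,\qquad \hat\tau=+\infty\quad\text{if }\lambda_{\min}\ge-1 .$$ If $\tau<\hat\tau$, then the game has exactly one Nash equilibrium. -/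

import Mathlib

/-- Convex cost of producing content at rate `y ≥ 0`, with the reference time period
normalized to one: `c(y) = y ^ (α + 1) / (α + 1)`. -/
noncomputable def effortCost (α y : ℝ) : ℝ := y ^ (α + 1) / (α + 1)

/-- Utility per unit of time `U(y_i, y_{-i}) = 1 - exp(-τ (y_i + y_{-i})) - c(y_i)` of a player who
exerts effort `own` and receives content at total rate `ext` from her neighbors, for content of
shelf time `τ`. -/
noncomputable def playerUtility (τ α own ext : ℝ) : ℝ :=
  1 - Real.exp (-τ * (own + ext)) - effortCost α own

/-- The total effort `y_{-i} = ∑ j ∈ N(i), y_j` of the neighbors of `i`. -/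
def neighborEffort {V : Type*} [Fintype V] (G : SimpleGraph V) [DecidableRel G.Adj]
    (y : V → ℝ) (i : V) : ℝ :=
  ∑ j ∈ G.neighborFinset i, y j

/-- `y` is a (pure) Nash equilibrium of the perishable public goods game on `G`: all efforts are
admissible (nonnegative), and no player gains by deviating to another nonnegative effort. The
neighbors' total effort does not depend on the player's own effort, as `G` has no loops. -/
def IsNashEquilibrium {V : Type*} [Fintype V] (G : SimpleGraph V) [DecidableRel G.Adj]
    (τ α : ℝ) (y : V → ℝ) : Prop :=
  (∀ i, 0 ≤ y i) ∧
    ∀ i, ∀ x : ℝ, 0 ≤ x →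
      playerUtility τ α x (neighborEffort G y i) ≤
        playerUtility τ α (y i) (neighborEffort G y i)

/-- The threshold
`(α / (-lam - 1)) ^ (α / (α + 1)) * exp (α / ((α + 1) * (-lam - 1)))`
for `lam < -1`; it is `+∞` for `lam ≥ -1` (complete graphs and edgeless graphs). -/
noncomputable def shelfTimeThreshold (α lam : ℝ) : EReal :=
  open Classical in
  if lam < -1 then
    (((α / (-lam - 1)) ^ (α / (α + 1)) * Real.exp (α / ((α + 1) * (-lam - 1))) : ℝ) : EReal)
  else ⊤

/-! Strict concavity in the own effort makes equilibria exactly the positive solutions of `α log y_i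
+ τ (y_i + y_{-i}) = log τ`, the critical point equations of a potential. A minimum of the potential
over a suitable box is such a solution. For uniqueness, subtract the equations of two equilibria and
pair with `d = y - z`: `α ∑ d_i (log y_i - log z_i) = -τ (|d|² + d·Ad) ≤ -τ (1 + λ) |d|²`. For `λ <
-1` the threshold is what confines every equilibrium effort below `c = α / (τ (-λ - 1))`, where
`log` has slope above `1/c`; the left side then exceeds `(α/c) |d|² = -τ (1 + λ) |d|²` unless `d =
0`. -/

open Matrix in
/-- The quadratic form of a real symmetric matrix is bounded below by its smallest eigenvalue. -/
theorem Matrix.IsHermitian.mul_dotProduct_self_le_of_hasEigenvalue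
    {V : Type*} [Fintype V] [DecidableEq V] {A : Matrix V V ℝ} (hA : A.IsHermitian) {l : ℝ}
    (hl : ∀ μ, Module.End.HasEigenvalue (Matrix.toLin' A) μ → l ≤ μ) (x : V → ℝ) :
    l * (x ⬝ᵥ x) ≤ x ⬝ᵥ A *ᵥ x := by
  have hB : (A - l • (1 : Matrix V V ℝ)).IsHermitian :=
    hA.sub (by simp [Matrix.IsHermitian])
  have hpos : (A - l • (1 : Matrix V V ℝ)).PosSemidef := by
    rw [hB.posSemidef_iff_eigenvalues_nonneg]
    intro j
    have h := hB.mulVec_eigenvectorBasis j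
    have hne : (hB.eigenvectorBasis j).ofLp ≠ 0 := by
      intro h0
      exact hB.eigenvectorBasis.orthonormal.ne_zero j (by ext i; simp [h0])
    have hev : Module.End.HasEigenvalue (Matrix.toLin' A) (hB.eigenvalues j + l) := by
      refine Module.End.hasEigenvalue_of_hasEigenvector
        (x := (hB.eigenvectorBasis j).ofLp) ⟨?_, hne⟩
      rw [Module.End.mem_eigenspace_iff, Matrix.toLin'_apply]
      rw [Matrix.sub_mulVec, Matrix.smul_mulVec, Matrix.one_mulVec] at h
      rw [add_smul, ← h, sub_add_cancel]
    have := hl _ hev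
    simp only [Pi.zero_apply]
    linarith
  have h := hpos.dotProduct_mulVec_nonneg x
  rw [Matrix.sub_mulVec, Matrix.smul_mulVec, Matrix.one_mulVec, dotProduct_sub,
    dotProduct_smul, smul_eq_mul, star_trivial] at h
  linarith

/-- First order condition at a minimum over a convex set of reals. -/
theorem IsMinOn.mul_sub_nonneg_of_hasDerivAt {f : ℝ → ℝ} {f' x y : ℝ} {s : Set ℝ}
    (h : IsMinOn f s x) (hs : Convex ℝ s) (hx : x ∈ s) (hy : y ∈ s) (hf : HasDerivAt f f' x) :
    0 ≤ (y - x) * f' := by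
  have := h.localize.hasFDerivWithinAt_nonneg hf.hasFDerivAt.hasFDerivWithinAt
    (sub_mem_posTangentConeAt_of_segment_subset (hs.segment_subset hx hy))
  simpa using this

/-- Strict strong monotonicity of the logarithm below `c`. -/
theorem Real.sq_sub_div_lt_of_ne {c a b : ℝ} (ha : 0 < a) (hb : 0 < b) (hac : a < c) (hbc : b < c)
    (hab : a ≠ b) : (a - b) ^ 2 / c < (a - b) * (Real.log a - Real.log b) := by
  wlog h : b < a generalizing a b
  · have := this hb ha hbc hac hab.symm (lt_of_le_of_ne (not_lt.1 h) hab)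
    convert this using 1 <;> ring
  have h1 : 1 - b / a ≤ Real.log a - Real.log b := by
    have := Real.log_le_sub_one_of_pos (div_pos hb ha)
    rw [Real.log_div hb.ne' ha.ne'] at this
    linarith
  have h2 : (a - b) / c < 1 - b / a := by
    rw [one_sub_div ha.ne']
    exact div_lt_div_of_pos_left (sub_pos.2 h) ha hac
  calc (a - b) ^ 2 / c = (a - b) * ((a - b) / c) := by ring
    _ < (a - b) * (Real.log a - Real.log b) :=
      mul_lt_mul_of_pos_left (h2.trans_le h1) (sub_pos.2 h)

/-! ### Best responses and the first order condition. -/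

theorem hasDerivAt_neg_playerUtility {τ α : ℝ} (hα : 0 < α) (s x : ℝ) :
    HasDerivAt (fun t => -playerUtility τ α t s) (x ^ α - τ * Real.exp (-τ * (x + s))) x := by
  have h1 : HasDerivAt (fun t => Real.exp (-τ * (t + s))) (Real.exp (-τ * (x + s)) * (-τ)) x := by
    have : HasDerivAt (fun t => -τ * (t + s)) (-τ) x := by
      simpa using ((hasDerivAt_id x).add_const s).const_mul (-τ)
    exact this.exp
  have h2 : HasDerivAt (fun t : ℝ => t ^ (α + 1) / (α + 1)) (x ^ α) x := by
    have := (Real.hasDerivAt_rpow_const (x := x) (p := α + 1) (Or.inr (by linarith))).div_const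
      (α + 1)
    rwa [add_sub_cancel_right, mul_div_cancel_left₀ _ (by linarith : α + 1 ≠ 0)] at this
  have h3 := ((h1.const_sub 1).sub h2).neg
  refine (h3.congr_deriv (by ring)).congr_of_eventuallyEq (Filter.Eventually.of_forall fun t => ?_)
  simp [playerUtility, effortCost]

/-- Tangent line inequality for power functions. -/
theorem Real.rpow_add_mul_le_rpow {α x y : ℝ} (hα : 0 < α) (hx : 0 ≤ x) (hy : 0 < y) :
    y ^ (α + 1) + (α + 1) * y ^ α * (x - y) ≤ x ^ (α + 1) := by
  -- Bernoulli's inequality at `x / y`, to be scaled by `y ^ (α + 1)`.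
  have h := one_add_mul_self_le_rpow_one_add (s := x / y - 1) (p := α + 1)
    (by have := div_nonneg hx hy.le; linarith) (by linarith)
  rw [add_sub_cancel, Real.div_rpow hx hy.le, le_div_iff₀ (Real.rpow_pos_of_pos hy _)] at h
  refine le_trans (le_of_eq ?_) h
  rw [Real.rpow_add_one hy.ne']
  field_simp

/-- A best response is characterized by the first order condition, which forces it to be
positive. -/
theorem isBestResponse_iff {τ α y s : ℝ} (hα : 0 < α) (hτ : 0 < τ) :
    (0 ≤ y ∧ ∀ x, 0 ≤ x → playerUtility τ α x s ≤ playerUtility τ α y s) ↔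
      0 < y ∧ α * Real.log y + τ * (y + s) = Real.log τ := by
  have key : ∀ y, 0 < y → (α * Real.log y + τ * (y + s) = Real.log τ ↔
      y ^ α = τ * Real.exp (-τ * (y + s))) := by
    intro y hy
    rw [← Real.log_injOn_pos.eq_iff (Set.mem_Ioi.2 (Real.rpow_pos_of_pos hy α))
      (Set.mem_Ioi.2 (by positivity)), Real.log_rpow hy,
      Real.log_mul hτ.ne' (Real.exp_pos _).ne', Real.log_exp]
    constructor <;> intro h <;> linarith
  constructor
  · rintro ⟨hy, h⟩
    have hmin : IsMinOn (fun t => -playerUtility τ α t s) (Set.Ici 0) y :=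
      fun x hx => neg_le_neg (h x hx)
    have hvar : ∀ x, 0 ≤ x → 0 ≤ (x - y) * (y ^ α - τ * Real.exp (-τ * (y + s))) := fun x hx =>
      hmin.mul_sub_nonneg_of_hasDerivAt (convex_Ici 0) hy hx (hasDerivAt_neg_playerUtility hα s y)
    have hpos : 0 < y := by
      -- At zero effort the marginal cost `0 ^ α` vanishes while the marginal benefit is positive.
      refine hy.lt_of_ne fun h0 => ?_
      subst h0
      have := hvar 1 zero_le_one
      rw [Real.zero_rpow hα.ne'] at this
      have := Real.exp_pos (-τ * (0 + s))
      nlinarith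
    refine ⟨hpos, (key y hpos).2 ?_⟩
    have h1 := hvar (y + 1) (by linarith)
    have h2 := hvar 0 le_rfl
    apply le_antisymm
    · nlinarith
    · linarith
  · rintro ⟨hy, h⟩
    refine ⟨hy.le, fun x hx => ?_⟩
    rw [key y hy] at h
    have h1 := Real.rpow_add_mul_le_rpow hα hx hy
    -- Tangent lines at `y` to the exponential and to the cost: by the first order condition their
    -- slopes cancel.
    have h2 : Real.exp (-τ * (y + s)) * (1 - τ * (x - y)) ≤ Real.exp (-τ * (x + s)) := by
      have : Real.exp (-τ * (x + s)) = Real.exp (-τ * (y + s)) * Real.exp (-τ * (x - y)) := by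
        rw [← Real.exp_add]; ring_nf
      rw [this]
      refine mul_le_mul_of_nonneg_left ?_ (Real.exp_pos _).le
      have := Real.add_one_le_exp (-τ * (x - y))
      linarith
    have h3 : y ^ (α + 1) / (α + 1) + y ^ α * (x - y) ≤ x ^ (α + 1) / (α + 1) := by
      have hα1 : 0 < α + 1 := by linarith
      rw [le_div_iff₀ hα1, add_mul, div_mul_cancel₀ _ hα1.ne']
      linarith
    unfold playerUtility effortCost
    rw [h] at h3
    linarith

theorem isNashEquilibrium_iff {V : Type*} [Fintype V] (G : SimpleGraph V) [DecidableRel G.Adj]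
    {τ α : ℝ} (hα : 0 < α) (hτ : 0 < τ) (y : V → ℝ) :
    IsNashEquilibrium G τ α y ↔
      ∀ i, 0 < y i ∧ α * Real.log (y i) + τ * (y i + neighborEffort G y i) = Real.log τ := by
  unfold IsNashEquilibrium
  rw [← forall_and]
  exact forall_congr' fun i => isBestResponse_iff hα hτ

/-! ### Potential and existence. -/

open Matrix in
/-- The potential of the game; its critical points are the Nash equilibria. -/
noncomputable def gamePotential {V : Type*} [Fintype V] (A : Matrix V V ℝ) (τ α : ℝ)
    (y : V → ℝ) : ℝ :=
  ∑ j, (α * (y j * Real.log (y j) - y j) + τ / 2 * y j ^ 2 - Real.log τ * y j)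
    + τ / 2 * (y ⬝ᵥ A *ᵥ y)

theorem continuous_gamePotential {V : Type*} [Fintype V] (A : Matrix V V ℝ) (τ α : ℝ) :
    Continuous (gamePotential A τ α) := by
  have hlog : ∀ j : V, Continuous fun y : V → ℝ => y j * Real.log (y j) := fun j =>
    Real.continuous_mul_log.comp (continuous_apply j)
  unfold gamePotential
  simp only [dotProduct, Matrix.mulVec]
  fun_prop

open Matrix in
theorem hasDerivAt_gamePotential_update {V : Type*} [Fintype V] [DecidableEq V]
    {A : Matrix V V ℝ} (hA : A.IsSymm) (hd : ∀ i, A i i = 0) (τ α : ℝ) (y : V → ℝ) (i : V)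
    (hy : y i ≠ 0) :
    HasDerivAt (fun t => gamePotential A τ α (Function.update y i t))
      (α * Real.log (y i) + τ * (y i + (A *ᵥ y) i) - Real.log τ) (y i) := by
  set ψ : ℝ → ℝ := fun x => α * (x * Real.log x - x) + τ / 2 * x ^ 2 - Real.log τ * x with hψ
  have hψd : HasDerivAt ψ (α * Real.log (y i) + τ * y i - Real.log τ) (y i) := by
    have h1 := ((Real.hasDerivAt_mul_log hy).sub (hasDerivAt_id (y i))).const_mul α
    have h2 := ((hasDerivAt_id (y i)).pow 2).const_mul (τ / 2)
    have h3 := (hasDerivAt_id (y i)).const_mul (Real.log τ)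
    refine ((h1.add h2).sub h3).congr_deriv ?_
    simp
    ring
  -- The zero diagonal removes the `t ^ 2` term, so the form is affine in one coordinate.
  have hquad : ∀ t, Function.update y i t ⬝ᵥ A *ᵥ Function.update y i t =
      y ⬝ᵥ A *ᵥ y + 2 * (t - y i) * (A *ᵥ y) i := by
    intro t
    have hu : Function.update y i t = y + Pi.single i (t - y i) := by
      ext j
      by_cases h : j = i
      · subst h; simp
      · simp [h]
    have hsym : y ⬝ᵥ A *ᵥ Pi.single i (t - y i) = (t - y i) * (A *ᵥ y) i := by
      rw [dotProduct_mulVec, ← mulVec_transpose, hA.eq, dotProduct_single, mul_comm]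
    rw [hu, mulVec_add, dotProduct_add, add_dotProduct, add_dotProduct, hsym,
      single_dotProduct, single_dotProduct, mulVec_single]
    simp [hd]
    ring
  have hfun : ∀ t, gamePotential A τ α (Function.update y i t) =
      ψ t + (∑ j ∈ Finset.univ.erase i, ψ (y j) + τ / 2 * (y ⬝ᵥ A *ᵥ y))
        + τ * (A *ᵥ y) i * (t - y i) := by
    intro t
    rw [gamePotential, hquad, ← Finset.add_sum_erase _ _ (Finset.mem_univ i),
      Finset.sum_congr rfl (fun j hj => by
        rw [Function.update_of_ne (Finset.ne_of_mem_erase hj)]), Function.update_self]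
    simp only [hψ]
    ring
  have hlin : HasDerivAt (fun t => τ * (A *ᵥ y) i * (t - y i)) (τ * (A *ᵥ y) i) (y i) := by
    simpa using ((hasDerivAt_id (y i)).sub_const (y i)).const_mul (τ * (A *ᵥ y) i)
  refine (((hψd.add_const _).add hlin).congr_deriv (by ring)).congr_of_eventuallyEq
    (Filter.Eventually.of_forall hfun)

theorem neighborEffort_eq_mulVec {V : Type*} [Fintype V] (G : SimpleGraph V) [DecidableRel G.Adj]
    (y : V → ℝ) : neighborEffort G y = (G.adjMatrix ℝ).mulVec y := by
  ext i
  rw [SimpleGraph.adjMatrix_mulVec_apply, neighborEffort]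

theorem exists_isNashEquilibrium {V : Type*} [Fintype V] [DecidableEq V] (G : SimpleGraph V)
    [DecidableRel G.Adj] {τ α : ℝ} (hα : 0 < α) (hτ : 0 < τ) :
    ∃ y, IsNashEquilibrium G τ α y := by
  simp only [isNashEquilibrium_iff G hα hτ]
  -- `B` makes each partial derivative nonnegative on the face `y i = B`; `K` makes it nonpositive
  -- on `y i = exp (-K)`, whatever the other coordinates in the box.
  set B : ℝ := 1 + |Real.log τ| / τ with hB
  have hB1 : 1 ≤ B := le_add_of_nonneg_right (by positivity)
  set K : ℝ := (τ * (1 + Fintype.card V * B) + |Real.log τ| + 1) / α with hK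
  have hK0 : 0 < K := by positivity
  set ε : ℝ := Real.exp (-K) with hε
  have hε0 : 0 < ε := Real.exp_pos _
  have hε1 : ε < 1 := by rw [hε, Real.exp_lt_one_iff]; linarith
  have hεB : ε ≤ B := hε1.le.trans hB1
  obtain ⟨y, hy, hmin⟩ := (isCompact_univ_pi fun _ : V => isCompact_Icc (a := ε) (b := B))
    |>.exists_isMinOn ⟨fun _ => ε, fun _ _ => Set.left_mem_Icc.2 hεB⟩
    (continuous_gamePotential (G.adjMatrix ℝ) τ α).continuousOn
  have hyi : ∀ i, ε ≤ y i ∧ y i ≤ B := fun i => hy i (Set.mem_univ i)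
  refine ⟨y, fun i => ?_⟩
  have hpos : 0 < y i := hε0.trans_le (hyi i).1
  refine ⟨hpos, ?_⟩
  have hd := hasDerivAt_gamePotential_update G.isSymm_adjMatrix (fun i => by simp) τ α y i hpos.ne'
  rw [← neighborEffort_eq_mulVec] at hd
  have hs0 : 0 ≤ neighborEffort G y i :=
    Finset.sum_nonneg fun j _ => hε0.le.trans (hyi j).1
  have hsB : neighborEffort G y i ≤ Fintype.card V * B := by
    calc neighborEffort G y i ≤ ∑ _j ∈ G.neighborFinset i, B :=
          Finset.sum_le_sum fun j _ => (hyi j).2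
      _ ≤ Fintype.card V * B := by
          rw [Finset.sum_const, nsmul_eq_mul]
          exact mul_le_mul_of_nonneg_right (by exact_mod_cast Finset.card_le_univ _) (by linarith)
  have hmin' : IsMinOn (fun t => gamePotential (G.adjMatrix ℝ) τ α (Function.update y i t))
      (Set.Icc ε B) (y i) := by
    intro t ht
    simp only [Set.mem_ofPred_eq, Function.update_eq_self]
    refine hmin fun j _ => ?_
    by_cases h : j = i
    · subst h; simpa using ht
    · simpa [h] using hyi j
  have hvar : ∀ x ∈ Set.Icc ε B, 0 ≤ (x - y i) *
      (α * Real.log (y i) + τ * (y i + neighborEffort G y i) - Real.log τ) := fun x hx =>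
    hmin'.mul_sub_nonneg_of_hasDerivAt (convex_Icc ε B) (hyi i) hx hd
  have hl := hvar ε (Set.left_mem_Icc.2 hεB)
  have hr := hvar B (Set.right_mem_Icc.2 hεB)
  have habs := neg_abs_le (Real.log τ)
  have habs' := le_abs_self (Real.log τ)
  rw [← sub_eq_zero]
  apply le_antisymm
  -- Off the lower face, minimality against moving down gives the sign; on it, the choice of `K`
  -- does.
  · rcases (hyi i).1.lt_or_eq with h | h
    · by_contra! hc
      nlinarith
    · rw [← h, hε, Real.log_exp, ← hε]
      have h1 : α * K = τ * (1 + Fintype.card V * B) + |Real.log τ| + 1 := by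
        rw [hK]; field_simp
      have h2 : τ * (ε + neighborEffort G y i) ≤ τ * (1 + Fintype.card V * B) :=
        mul_le_mul_of_nonneg_left (by linarith) hτ.le
      linarith
  · rcases (hyi i).2.lt_or_eq with h | h
    · by_contra! hc
      nlinarith
    · rw [h]
      have h1 : τ * B = τ + |Real.log τ| := by rw [hB]; field_simp
      have h2 : 0 ≤ α * Real.log B := mul_nonneg hα.le (Real.log_nonneg hB1)
      have h3 : 0 ≤ τ * neighborEffort G y i := mul_nonneg hτ.le hs0
      linarith

/-! ### Threshold and uniqueness. -/

/-- Below the threshold, efforts satisfying the bound coming from the first order condition are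
smaller than some `c` with `-lam - 1 ≤ α / (τ * c)`. -/
theorem exists_bound_of_lt_shelfTimeThreshold {α τ lam : ℝ} (hα : 0 < α) (hτ : 0 < τ)
    (h : (τ : EReal) < shelfTimeThreshold α lam) (hlam : lam < -1) :
    ∃ c, 0 < c ∧ α / c = τ * (-lam - 1) ∧
      ∀ x, 0 < x → α * Real.log x + τ * x ≤ Real.log τ → x < c := by
  rw [shelfTimeThreshold, if_pos hlam, EReal.coe_lt_coe_iff] at h
  have hm : 0 < -lam - 1 := by linarith
  generalize -lam - 1 = m at h hm ⊢
  have hc : 0 < α / (m * τ) := by positivity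
  refine ⟨α / (m * τ), hc, by field_simp, fun x hx hle => ?_⟩
  -- By monotonicity `x ≥ c` would give `α log c + τ c ≤ log τ`, which says that `τ` is at least the
  -- threshold.
  by_contra! hcx
  have hα1 : 0 < α + 1 := by linarith
  have h1 := Real.log_lt_log hτ h
  rw [Real.log_mul (Real.rpow_pos_of_pos (by positivity) _).ne' (Real.exp_pos _).ne',
    Real.log_exp, Real.log_rpow (by positivity)] at h1
  have h2 : (α + 1) * Real.log τ < α * Real.log (α / m) + α / m := by
    have := mul_lt_mul_of_pos_left h1 hα1
    refine this.trans_eq ?_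
    field_simp
  have h3 : Real.log (α / (m * τ)) = Real.log (α / m) - Real.log τ := by
    rw [← div_div, Real.log_div (by positivity) hτ.ne']
  have h4 : τ * (α / (m * τ)) = α / m := by field_simp
  have h5 := mul_le_mul_of_nonneg_left (Real.log_le_log hc hcx) hα.le
  have h6 := mul_le_mul_of_nonneg_left hcx hτ.le
  rw [h3] at h5
  rw [h4] at h6
  linarith

open Matrix in
theorem IsNashEquilibrium.eq_of_lt_shelfTimeThreshold {V : Type*} [Fintype V] [DecidableEq V]
    (G : SimpleGraph V) [DecidableRel G.Adj] {lam α τ : ℝ}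
    (hlam : ∀ μ, Module.End.HasEigenvalue (Matrix.toLin' (G.adjMatrix ℝ)) μ → lam ≤ μ)
    (hα : 0 < α) (hτ : 0 < τ) (h : (τ : EReal) < shelfTimeThreshold α lam) {y z : V → ℝ}
    (hy : IsNashEquilibrium G τ α y) (hz : IsNashEquilibrium G τ α z) : y = z := by
  rw [isNashEquilibrium_iff G hα hτ] at hy hz
  have hbd : ∀ w : V → ℝ, (∀ i, 0 < w i ∧
      α * Real.log (w i) + τ * (w i + neighborEffort G w i) = Real.log τ) →
      ∀ i, α * Real.log (w i) + τ * w i ≤ Real.log τ := by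
    intro w hw i
    have h1 : 0 ≤ neighborEffort G w i := Finset.sum_nonneg fun j _ => (hw j).1.le
    have h2 := (hw i).2
    have h3 := mul_nonneg hτ.le h1
    linarith
  have hstrict : ∀ i, y i ≠ z i → -(τ * (1 + lam) * (y i - z i) ^ 2) <
      α * ((y i - z i) * (Real.log (y i) - Real.log (z i))) := by
    intro i hi
    by_cases hl : lam < -1
    · obtain ⟨c, hc, hceq, hlt⟩ := exists_bound_of_lt_shelfTimeThreshold hα hτ h hl
      have h1 := mul_lt_mul_of_pos_left (Real.sq_sub_div_lt_of_ne (hy i).1 (hz i).1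
        (hlt _ (hy i).1 (hbd y hy i)) (hlt _ (hz i).1 (hbd z hz i)) hi) hα
      have h2 : α * ((y i - z i) ^ 2 / c) = -(τ * (1 + lam) * (y i - z i) ^ 2) := by
        calc α * ((y i - z i) ^ 2 / c) = α / c * (y i - z i) ^ 2 := by ring
          _ = _ := by rw [hceq]; ring
      linarith
    -- Here the left side is nonpositive, so strict monotonicity of `log` suffices and any `c` above
    -- both efforts serves.
    · have hc : 0 < max (y i) (z i) + 1 := by
        have := le_max_left (y i) (z i)
        have := (hy i).1
        linarith
      have h1 := Real.sq_sub_div_lt_of_ne (hy i).1 (hz i).1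
        ((le_max_left (y i) (z i)).trans_lt (lt_add_one _))
        ((le_max_right (y i) (z i)).trans_lt (lt_add_one _)) hi
      have h2 : 0 ≤ (y i - z i) ^ 2 / (max (y i) (z i) + 1) := by positivity
      have h3 := mul_pos hα (h2.trans_lt h1)
      have h4 : 0 ≤ τ * (1 + lam) * (y i - z i) ^ 2 :=
        mul_nonneg (mul_nonneg hτ.le (by linarith)) (sq_nonneg _)
      linarith
  by_contra hne
  obtain ⟨k, hk⟩ := Function.ne_iff.1 hne
  have hsum : ∑ i, -(τ * (1 + lam) * (y i - z i) ^ 2) <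
      ∑ i, α * ((y i - z i) * (Real.log (y i) - Real.log (z i))) := by
    refine Finset.sum_lt_sum (fun i _ => ?_) ⟨k, Finset.mem_univ k, hstrict k hk⟩
    by_cases hi : y i = z i
    · simp [hi]
    · exact (hstrict i hi).le
  have hfoc : ∀ i, α * ((y i - z i) * (Real.log (y i) - Real.log (z i))) =
      -(τ * ((y i - z i) ^ 2 + (y i - z i) * (G.adjMatrix ℝ *ᵥ (y - z)) i)) := by
    intro i
    have h1 := (hy i).2
    have h2 := (hz i).2
    rw [neighborEffort_eq_mulVec] at h1 h2
    rw [mulVec_sub, Pi.sub_apply]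
    linear_combination (y i - z i) * (h1 - h2)
  have hquad := G.isHermitian_adjMatrix (R := ℝ)
    |>.mul_dotProduct_self_le_of_hasEigenvalue hlam (y - z)
  have hsq : (y - z) ⬝ᵥ (y - z) = ∑ i, (y i - z i) ^ 2 := by
    simp [dotProduct, sq]
  have hform : (y - z) ⬝ᵥ G.adjMatrix ℝ *ᵥ (y - z) =
      ∑ i, (y i - z i) * (G.adjMatrix ℝ *ᵥ (y - z)) i := rfl
  rw [hsq, hform] at hquad
  simp only [hfoc, Finset.sum_neg_distrib, ← Finset.mul_sum, Finset.sum_add_distrib] at hsum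
  have := mul_le_mul_of_nonneg_left hquad hτ.le
  linarith

theorem theorem2 {V : Type*} [Fintype V] [DecidableEq V]
    (G : SimpleGraph V) [DecidableRel G.Adj]
    (lamMin : ℝ)
    (hlamMin : IsLeast
      {μ : ℝ | Module.End.HasEigenvalue (Matrix.toLin' (G.adjMatrix ℝ)) μ} lamMin)
    (α τ : ℝ) (hα : 0 < α) (hτ : 0 < τ)
    (hτ_lt : (τ : EReal) < shelfTimeThreshold α lamMin) :
    ∃! y : V → ℝ, IsNashEquilibrium G τ α y := by
  obtain ⟨y, hy⟩ := exists_isNashEquilibrium G hα hτ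
  exact ⟨y, hy, fun z hz => IsNashEquilibrium.eq_of_lt_shelfTimeThreshold G
    (fun _ hμ => hlamMin.2 hμ) hα hτ hτ_lt hz hy⟩
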